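/- Let $\mathbb{F}$ be a finite field of characteristic $p$ and let $\mathbb{F}((t^{-1}))$ be the completion of $\mathbb{F}(t)$ at infinity. A polynomial $\eta(y)$ over $\mathbb{F}((t^{-1}))$ is \emph{additive} if $\eta(x+y)=\eta(x)+\eta(y)$ for all $x,y\in\mathbb{F}((t^{-1}))$. With $\partial_u g(x)=g(x+u)-g(x)$ and $\partial_{u_1,\dots,u_k}=\partial_{u_k}\partial_{u_1,\dots,u_{k-1}}$, the \emph{derivational degree} of a polynomial $P(y)$ over $\mathbb{F}((t^{-1}))$ is the minimum $e\ge 0$ such that $\partial_{u_1,\dots,u_{e+1}}P(y)=0$ for all $u_1,\dots,u_{e+1},y\in\mathbb{F}((t^{-1}))$. For a monic $Q\in\mathbb{F}[t]$ put $\mathbb{F}[t]_Q=\mathbb{F}[t]/Q\mathbb{F}[t]$, and let $\mathrm{lpf}(Q)$ be the least value of $|\mathbb{F}|^{\deg R}$ over the monic irreducible factors $R$ of $Q$. For a finite nonempty set $S$ and $f:S\to\mathbb{C}$ write $\mathbb{E}_{x\in S}f(x)=\frac1{|S|}\sum_{x\in S}f(x)$ and $\|f\|_{L^2(S)}=\left(\mathbb{E}_{x\in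 S}|f(x)|^2\right)^{1/2}$. Proposition. Let $P(y)\in(\mathbb{F}[t])[y]$ be a nonconstant polynomial of degree $d$ and derivational degree $k$. Write $P(y)=a_0+\sum_{i=1}^n\eta_i(y^{r_i})$, where $a_0\in\mathbb{F}[t]$, the polynomials $\eta_i\in(\mathbb{F}[t])[y]$ are additive, and the $r_i$ are distinct positive integers not divisible by $p$. Let $H=\sum_{i=1}^n\eta_i(\mathbb{F}[t])$, and for monic $Q$ let $H_Q=\{z \bmod Q: z\in H\}\subseteq\mathbb{F}[t]_Q$. Then for every monic $Q\in\mathbb{F}[t]$, every $m\in\mathbb{N}$ and every $f:\mathbb{F}[t]_Q^m\to\mathbb{C}$, $$\left\|\mathbb{E}_{y\in\mathbb{F}[t]_Q}f(x_1+P(y),\dots,x_m+P(y))-\mathbb{E}_{z\in H_Q}f(x_1+a_0+z,\dots,x_m+a_0+z)\right\|_{L^2(\mathbb{F}[t]_Q^m)}\le\left(p^{2\lfloor\log_p d\rfloor}\,\frac{k-1}{\mathrm{lpf}(Q)}\right)^{1/2^{k-1}}\|f\|_{L^2(\mathbb{F}[t]_Q^m)},$$ where the norm on the left is taken in the variables $(x_1,\dots,x_m)$.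 For $Q=1$, which has no irreducible factor, the right-hand side is read as $0$. -/

import Mathlib

open Polynomial

noncomputable section

/-! ### Polynomials over `𝔽((t⁻¹))` -/

/-- The field `𝔽((t⁻¹))`, the completion of `𝔽(t)` at infinity. -/
abbrev LaurentAtInfty (F : Type*) [Field F] : Type _ :=
  letI : DecidableEq (RatFunc F) := Classical.decEq _
  RatFunc.CompletionAtInfty F

/-- The inclusion `𝔽[t] ⊆ 𝔽((t⁻¹))`. -/
def toLaurentAtInfty (F : Type*) [Field F] : F[X] →+* LaurentAtInfty F :=
  letI : DecidableEq (RatFunc F) := Classical.decEq _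
  (algebraMap (RatFunc F) (RatFunc.CompletionAtInfty F)).comp (algebraMap F[X] (RatFunc F))

/-- A polynomial `η` over `K` is additive if `η(x + y) = η(x) + η(y)` for all `x, y ∈ K`. -/
def IsAdditivePoly {K : Type*} [CommRing K] (η : K[X]) : Prop :=
  ∀ x y : K, η.eval (x + y) = η.eval x + η.eval y

/-- `iterDiff [u₁, …, u_k] g = ∂_{u₁, …, u_k} g`, where `∂_u g (x) = g (x + u) - g x` and
`∂_{u₁, …, u_k} = ∂_{u_k} ∂_{u₁, …, u_{k-1}}`. -/
def iterDiff {K : Type*} [CommRing K] (u : List K) (g : K → K) : K → K :=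
  u.foldl (fun h v => fwdDiff v h) g

/-- The derivational degree of a polynomial `P` over `K`: the minimum `e ≥ 0` such that
`∂_{u₁, …, u_{e+1}} P (y) = 0` for all `u₁, …, u_{e+1}, y ∈ K`. -/
def derivDegree {K : Type*} [CommRing K] (P : K[X]) : ℕ :=
  sInf {e : ℕ | ∀ u : List K, u.length = e + 1 → ∀ y : K, iterDiff u (fun x => P.eval x) y = 0}

/-- The set in the definition of the derivational degree is nonempty, so that the infimum there is
a minimum. -/
theorem derivDegree_isLeast {K : Type*} [CommRing K] (P : K[X]) :
    IsLeast {e : ℕ | ∀ u : List K, u.length = e + 1 →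
      ∀ y : K, iterDiff u (fun x => P.eval x) y = 0} (derivDegree P) := by
  have key : ∀ (n : ℕ) (P : K[X]), P.degree < n → ∀ u : List K, u.length = n →
      ∀ y : K, iterDiff u (fun x => P.eval x) y = 0 := by
    intro n
    induction n with
    | zero =>
      intro P hP u hu y
      have h0 : P = 0 := by
        rw [← Polynomial.degree_eq_bot]
        exact (Nat.WithBot.lt_zero_iff).1 (by simpa using hP)
      obtain rfl := List.length_eq_zero_iff.1 hu
      simp [iterDiff, h0]
    | succ n ih =>
      intro P hP u hu y
      obtain ⟨v, w, rfl⟩ := List.exists_cons_of_length_eq_add_one hu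
      have e1 : fwdDiff v (fun x => P.eval x) =
          fun x => (Polynomial.taylor v P - P).eval x := by
        funext x
        simp [fwdDiff, Polynomial.taylor_eval]
      have e2 : (Polynomial.taylor v P - P).degree < n := by
        rw [Polynomial.degree_lt_iff_coeff_zero] at hP ⊢
        intro m hm
        rcases hm.eq_or_lt with rfl | hm
        · have hd : P.natDegree ≤ n := Polynomial.natDegree_le_iff_coeff_eq_zero.2
            fun N hN => hP N hN
          rcases hd.eq_or_lt with h | h
          · subst h
            rw [Polynomial.coeff_sub, Polynomial.coeff_taylor_natDegree]
            simp
          · rw [Polynomial.coeff_sub, Polynomial.coeff_eq_zero_of_natDegree_lt h,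
              Polynomial.coeff_eq_zero_of_natDegree_lt
                (by rwa [Polynomial.natDegree_taylor])]
            simp
        · have hd : P.natDegree < m := lt_of_le_of_lt
            (Polynomial.natDegree_le_iff_coeff_eq_zero.2 fun N hN => hP N hN) hm
          rw [Polynomial.coeff_sub, Polynomial.coeff_eq_zero_of_natDegree_lt hd,
            Polynomial.coeff_eq_zero_of_natDegree_lt (by rwa [Polynomial.natDegree_taylor])]
          simp
      have := ih _ e2 w (by simpa using hu) y
      simpa [iterDiff, e1] using this
  refine ⟨Nat.sInf_mem ⟨P.natDegree, fun u hu y => key _ P ?_ u hu y⟩, fun e he => Nat.sInf_le he⟩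
  exact lt_of_le_of_lt Polynomial.degree_le_natDegree (by exact_mod_cast Nat.lt_succ_self _)

/-! ### The quotient rings `𝔽[t]_Q` -/

/-- The quotient ring `𝔽[t]_Q = 𝔽[t] / Q 𝔽[t]`. -/
abbrev QuotRing {F : Type*} [Field F] (Q : F[X]) : Type _ := F[X] ⧸ Ideal.span {Q}

/-- `𝔽[t]_Q` is finite, so that the averages below are averages over finite sets. -/
theorem finite_quotRing {F : Type*} [Field F] [Finite F] {Q : F[X]} (hQ : Q.Monic) :
    Finite (QuotRing Q) := by
  have : Module.Finite F (QuotRing Q) := hQ.finite_quotient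
  exact Module.finite_of_finite F

/-- `lpf(Q)`, the least size `|R| = |𝔽| ^ deg R` of a monic irreducible factor `R` of `Q`.
For `Q = 1`, which has no such factor, the value is the convention `0`. -/
def lpf {F : Type*} [Field F] (Q : F[X]) : ℕ :=
  sInf {N : ℕ | ∃ R : F[X], R.Monic ∧ Irreducible R ∧ R ∣ Q ∧ N = Nat.card F ^ R.natDegree}

/-! ### Averages and `L²` norms -/

/-- The average of `f` over a finite set `S`. -/
def avg {α E : Type*} [Field E] (S : Set α) (f : α → E) : E :=
  (1 / (S.ncard : E)) * ∑ᶠ x ∈ S, f x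

/-- The norm of `f` in `L²(α)`, for a finite set `α` with normalized counting measure. -/
def L2norm {α : Type*} (f : α → ℂ) : ℝ :=
  Real.sqrt (avg Set.univ fun x => ‖f x‖ ^ 2)

/-! ### The subgroup attached to additive polynomials -/

/-- `H = ∑ᵢ Hᵢ`, where `Hᵢ = ηᵢ(𝔽[t])`. -/
def sumOfImages {F : Type*} [Field F] {n : ℕ} (η : Fin n → F[X][X]) : Set F[X] :=
  {h | ∃ y : Fin n → F[X], h = ∑ i, (η i).eval (y i)}

/-- `H_Q`, the set of residues mod `Q` of the elements of `H = ∑ᵢ ηᵢ(𝔽[t])`. -/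
def sumOfImagesMod {F : Type*} [Field F] {n : ℕ} (η : Fin n → F[X][X]) (Q : F[X]) :
    Set (QuotRing Q) :=
  (fun h : F[X] => (Ideal.Quotient.mk (Ideal.span {Q}) h : QuotRing Q)) '' sumOfImages η

end

/-! The operator is convolution with a signed measure on the diagonal, so by Parseval its `L²` norm
is at most its largest Fourier multiplier (`L2norm_sum_mul_comp_add_le`). A character of the product
restricts to a character `ψ` on the diagonal. If `ψ` is trivial on `H_Q`, both averages equal
`ψ(a₀)` and cancel. Otherwise the average over `H_Q` vanishes, and the normalized sum of `ψ(P(y))`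
remains to be bounded (`norm_sum_addChar_aeval_le`).

Up to a unimodular constant, `ψ(P(y))` is a product of `ψᵣ(y ^ r)` with `p ∤ r`. The complexity of a
term is the base `p` digit sum of `r`, which is at most the derivational degree. Weyl differencing
lowers it: a monomial `y ^ a` survives from `(y + u) ^ r` only if `p ∤ r.choose a`, that is, if
digit sums add without carries. Writing `a = b * p ^ j` with `p ∤ b`, Frobenius is absorbed into the
character, so the derivative has the same shape (`charProd_add`).

The top complexity drops by exactly one unless `u` is exceptional. Over a suitable residue field,
exceptional `u` come from roots of a nonzero polynomial of degree at most `p ^ (2 * L)`, hence have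
density at most `p ^ (2 * L) / lpf Q` (`exists_card_diffChar_eq_one_le`). At digit sum one only `r =
1` is left, and the sum of a nontrivial character is zero. Each differencing step adds one
exceptional density, which yields the factor `k - 1`. -/

noncomputable section

/-! ### Digit sums in a prime base -/

/-- The sum of the base `p` digits of `n`. -/
def digitSum (p n : ℕ) : ℕ := (p.digits n).sum

lemma digitSum_zero (p : ℕ) : digitSum p 0 = 0 := by simp [digitSum]

lemma digitSum_eq {p : ℕ} (hp : 1 < p) (n : ℕ) : digitSum p n = n % p + digitSum p (n / p) := by
  rcases Nat.eq_zero_or_pos n with rfl | hn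
  · simp [digitSum]
  · simp [digitSum, Nat.digits_def' hp hn]

lemma digitSum_mul_add {p : ℕ} (hp : 1 < p) (q : ℕ) {b : ℕ} (hb : b < p) :
    digitSum p (p * q + b) = b + digitSum p q := by
  rw [digitSum_eq hp, Nat.mul_add_mod, Nat.mod_eq_of_lt hb, Nat.mul_add_div (by omega),
    Nat.div_eq_of_lt hb, add_zero]

lemma digitSum_pos {p : ℕ} (hp : 1 < p) {n : ℕ} (hn : 0 < n) : 0 < digitSum p n := by
  induction n using Nat.strong_induction_on with
  | _ n ih =>
    rw [digitSum_eq hp]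
    rcases Nat.eq_zero_or_pos (n % p) with h | h
    · have h1 : 0 < n / p := Nat.div_pos (Nat.le_of_dvd hn (Nat.dvd_of_mod_eq_zero h)) (by omega)
      have := ih (n / p) (Nat.div_lt_self hn hp) h1
      omega
    · omega

lemma digitSum_mul_pow {p : ℕ} (hp : 1 < p) (n j : ℕ) : digitSum p (n * p ^ j) = digitSum p n := by
  induction j with
  | zero => simp
  | succ j ih =>
    have := digitSum_mul_add hp (n * p ^ j) (b := 0) (by omega)
    rw [← ih, pow_succ, ← mul_assoc, mul_comm _ p]
    simpa using this

lemma digitSum_pow {p : ℕ} (hp : 1 < p) (e : ℕ) : digitSum p (p ^ e) = 1 := by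
  have := digitSum_mul_pow hp 1 e
  rw [one_mul] at this
  rw [this]
  have := digitSum_mul_add hp 0 hp
  simpa [digitSum_zero] using this

lemma exists_eq_pow_of_digitSum_eq_one {p : ℕ} (hp : 1 < p) {n : ℕ} (hn : digitSum p n = 1) :
    ∃ e, n = p ^ e := by
  induction n using Nat.strong_induction_on with
  | _ n ih =>
    have hn0 : 0 < n := by
      rcases Nat.eq_zero_or_pos n with rfl | h
      · simp [digitSum] at hn
      · exact h
    have h := digitSum_eq hp n
    have hdm := Nat.div_add_mod n p
    rcases Nat.eq_zero_or_pos (n % p) with h0 | h0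
    · obtain ⟨e, he⟩ := ih (n / p) (Nat.div_lt_self hn0 hp) (by omega)
      refine ⟨e + 1, ?_⟩
      rw [he, h0] at hdm
      rw [pow_succ, mul_comm]
      omega
    · have h1 : n / p = 0 := by
        by_contra hne
        have := digitSum_pos hp (Nat.pos_of_ne_zero hne)
        omega
      refine ⟨0, ?_⟩
      rw [h1, digitSum_zero] at h
      rw [h1] at hdm
      simp only [mul_zero, zero_add] at hdm
      rw [pow_zero]
      omega

/-- Removing the leading digit, once, lowers the digit sum by one. -/
lemma exists_digitSum_sub_pow {p : ℕ} (hp : 1 < p) {n : ℕ} (hn : 0 < n) :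
    ∃ e, p ^ e ≤ n ∧ digitSum p (n - p ^ e) + 1 = digitSum p n ∧
      (2 ≤ digitSum p n → ¬ p ∣ n → ¬ p ∣ n - p ^ e) := by
  induction n using Nat.strong_induction_on with
  | _ n ih =>
    have hdm := Nat.div_add_mod n p
    have hb : n % p < p := Nat.mod_lt _ (by omega)
    rcases Nat.eq_zero_or_pos (n / p) with h0 | h0
    · have hnp : n < p := by
        rw [h0, mul_zero, zero_add] at hdm
        omega
      have hs : ∀ b < p, digitSum p b = b := fun b hb => by
        simpa [digitSum_zero] using digitSum_mul_add hp 0 hb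
      refine ⟨0, by rw [pow_zero]; omega, ?_, ?_⟩
      · rw [pow_zero, hs n hnp, hs (n - 1) (by omega)]
        omega
      · intro h2 _ hd
        rw [hs n hnp] at h2
        have := Nat.le_of_dvd (by simpa using (by omega : 1 < n)) hd
        simp only [pow_zero] at this
        omega
    · obtain ⟨e, he, hs, -⟩ := ih (n / p) (Nat.div_lt_self hn hp) h0
      have hle : p ^ (e + 1) ≤ p * (n / p) := by
        rw [pow_succ, mul_comm]
        exact Nat.mul_le_mul_left _ he
      have hsub : n - p ^ (e + 1) = p * (n / p - p ^ e) + n % p := by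
        rw [Nat.mul_sub, ← pow_succ']
        omega
      refine ⟨e + 1, by omega, ?_, ?_⟩
      · rw [hsub, digitSum_mul_add hp _ hb, digitSum_eq hp n]
        omega
      · intro _ hd hd'
        rw [hsub] at hd'
        have h1 : p ∣ n % p := (Nat.dvd_add_right (dvd_mul_right _ _)).1 hd'
        exact hd ((Nat.dvd_mod_iff dvd_rfl).1 h1)

/-- Legendre's formula: `(p - 1)` times the valuation of the binomial coefficient is the excess of
digit sums. The subtraction is truncated, so valuation zero gives an inequality. -/
lemma digitSum_add_le_of_not_dvd_choose {p : ℕ} (hp : p.Prime) {n a : ℕ} (ha : a ≤ n)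
    (h : ¬ p ∣ n.choose a) : digitSum p a + digitSum p (n - a) ≤ digitSum p n := by
  have : Fact p.Prime := ⟨hp⟩
  have h1 := sub_one_mul_padicValNat_choose_eq_sub_sum_digits (p := p) ha
  rw [padicValNat.eq_zero_of_not_dvd h, mul_zero] at h1
  exact Nat.sub_eq_zero_iff_le.1 h1.symm

lemma not_dvd_choose_of_digitSum_add_le {p : ℕ} (hp : p.Prime) {n a : ℕ} (ha : a ≤ n)
    (h : digitSum p a + digitSum p (n - a) ≤ digitSum p n) : ¬ p ∣ n.choose a := by
  have : Fact p.Prime := ⟨hp⟩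
  have h1 := sub_one_mul_padicValNat_choose_eq_sub_sum_digits (p := p) ha
  replace h1 := h1.trans (Nat.sub_eq_zero_of_le h)
  intro hd
  have h2 := one_le_padicValNat_of_dvd (Nat.choose_pos ha).ne' hd
  have h3 := hp.two_le
  rcases Nat.mul_eq_zero.1 h1 with h4 | h4 <;> omega

lemma exists_lower_digitSum {p : ℕ} (hp : p.Prime) {n : ℕ} (hn : 0 < n) :
    ∃ e, p ^ e ≤ n ∧ digitSum p (n - p ^ e) + 1 = digitSum p n ∧
      (2 ≤ digitSum p n → ¬ p ∣ n → ¬ p ∣ n - p ^ e) ∧ ¬ p ∣ n.choose (n - p ^ e) := by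
  obtain ⟨e, h1, h2, h3⟩ := exists_digitSum_sub_pow hp.one_lt hn
  refine ⟨e, h1, h2, h3, not_dvd_choose_of_digitSum_add_le hp (Nat.sub_le _ _) ?_⟩
  rw [Nat.sub_sub_self h1, digitSum_pow hp.one_lt]
  exact h2.le

/-! ### Differences of polynomials over infinite fields of characteristic `p` -/

section InfiniteField

variable {K : Type*} [Field K]

lemma coeff_taylor_eq_sum (P : K[X]) (u : K) (a : ℕ) :
    (taylor u P).coeff a =
      ∑ r ∈ P.support, P.coeff r * (r.choose a : K) * u ^ (r - a) := by
  rw [taylor_coeff, hasseDeriv_apply, sum_def, eval_finsetSum]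
  refine Finset.sum_congr rfl fun r _ => ?_
  rw [eval_monomial]
  ring

/-- The polynomial in `u` whose value is the coefficient of `y ^ a` in `P(y + u) - P(y)`. -/
def diffCoeff (P : K[X]) (a : ℕ) : K[X] :=
  ∑ r ∈ P.support.filter (a < ·), monomial (r - a) (P.coeff r * (r.choose a : K))

lemma eval_diffCoeff (P : K[X]) (u : K) (a : ℕ) :
    (diffCoeff P a).eval u = (taylor u P - P).coeff a := by
  rw [coeff_sub, coeff_taylor_eq_sum, diffCoeff, eval_finsetSum,
    ← Finset.sum_filter_add_sum_filter_not P.support (a < ·), add_sub_assoc]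
  have : ∑ r ∈ P.support.filter (¬ a < ·), P.coeff r * (r.choose a : K) * u ^ (r - a) =
      P.coeff a := by
    rw [Finset.sum_eq_single a]
    · simp
    · intro b hb hba
      rw [Finset.mem_filter] at hb
      rw [Nat.choose_eq_zero_of_lt (by omega)]
      simp
    · intro h
      have : P.coeff a = 0 := by simpa using h
      simp [this]
  rw [this, sub_self, add_zero]
  exact Finset.sum_congr rfl fun r _ => by rw [eval_monomial]

lemma coeff_diffCoeff (P : K[X]) {a r : ℕ} (har : a < r) :
    (diffCoeff P a).coeff (r - a) = P.coeff r * (r.choose a : K) := by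
  rw [diffCoeff, finsetSum_coeff, Finset.sum_eq_single r]
  · simp
  · intro b hb hbr
    rw [Finset.mem_filter] at hb
    rw [coeff_monomial, if_neg (by omega)]
  · intro h
    have : P.coeff r = 0 := by simpa [har] using h
    simp [this]

variable [Infinite K] (p : ℕ) [CharP K p]

/-- Take `i` from `exists_lower_digitSum`. The coefficient of `y ^ (r - p ^ i)` in the derivative is
a nonzero polynomial in the direction `u`, since its `u ^ (p ^ i)` term survives. Infinitude of `K`
supplies a good `u`, and one unit of digit sum is spent per derivative. -/
lemma exists_iterDiff_ne_zero (hp : p.Prime) (e : ℕ) : ∀ (P : K[X]) (r : ℕ), P.coeff r ≠ 0 →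
    e ≤ digitSum p r → ∃ u : List K, u.length = e ∧ ∃ y, iterDiff u (fun x => P.eval x) y ≠ 0 := by
  induction e with
  | zero =>
    intro P r hr _
    refine ⟨[], rfl, ?_⟩
    by_contra! h
    have : P = 0 := Polynomial.funext fun y => by simpa [iterDiff] using h y
    simp [this] at hr
  | succ e ih =>
    intro P r hr he
    have hr0 : 0 < r := by
      rcases Nat.eq_zero_or_pos r with rfl | h
      · simp [digitSum] at he
      · exact h
    obtain ⟨i, hi, hs, -, hc⟩ := exists_lower_digitSum hp hr0
    have hlt : r - p ^ i < r := Nat.sub_lt hr0 (pow_pos hp.pos _)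
    have hne : diffCoeff P (r - p ^ i) ≠ 0 := by
      intro h0
      have h1 := coeff_diffCoeff P hlt
      rw [h0, coeff_zero, eq_comm, mul_eq_zero, CharP.cast_eq_zero_iff K p] at h1
      exact h1.elim hr hc
    obtain ⟨u, hu⟩ : ∃ u, (diffCoeff P (r - p ^ i)).eval u ≠ 0 := by
      by_contra! h
      exact hne (Polynomial.funext fun y => by simpa using h y)
    rw [eval_diffCoeff] at hu
    obtain ⟨l, hl, y, hy⟩ := ih _ _ hu (by omega)
    refine ⟨u :: l, by simp [hl], y, ?_⟩
    have e1 : fwdDiff u (fun x => P.eval x) = fun x => (taylor u P - P).eval x := by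
      funext x
      simp [fwdDiff, taylor_eval]
    simpa [iterDiff, e1] using hy

lemma digitSum_le_derivDegree (hp : p.Prime) (P : K[X]) {r : ℕ} (hr : P.coeff r ≠ 0) :
    digitSum p r ≤ derivDegree P := by
  by_contra! h
  obtain ⟨u, hu, y, hy⟩ := exists_iterDiff_ne_zero p hp (derivDegree P + 1) P r hr h
  exact hy ((derivDegree_isLeast P).1 u hu y)

/-- The derivative of an additive polynomial is constant in `y`, so the surviving exponent `r - p ^
i` must be zero. -/
lemma IsAdditivePoly.exists_eq_pow (hp : p.Prime) {η : K[X]} (hη : IsAdditivePoly η) {r : ℕ}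
    (hr : η.coeff r ≠ 0) : ∃ e, r = p ^ e := by
  have h0 : η.coeff 0 = 0 := by
    have := hη 0 0
    rw [add_zero, left_eq_add] at this
    rwa [coeff_zero_eq_eval_zero]
  have hr0 : 0 < r := Nat.pos_of_ne_zero fun h => hr (h ▸ h0)
  obtain ⟨i, hi, hs, -, hc⟩ := exists_lower_digitSum hp hr0
  have hlt : r - p ^ i < r := Nat.sub_lt hr0 (pow_pos hp.pos _)
  refine ⟨i, ?_⟩
  by_contra hne
  have hz : diffCoeff η (r - p ^ i) = 0 := Polynomial.funext fun u => by
    have h1 : taylor u η - η = C (η.eval u) := Polynomial.funext fun y => by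
      rw [eval_sub, taylor_eval, hη, eval_C, add_sub_cancel_left]
    rw [eval_diffCoeff, h1, coeff_C, if_neg (by omega), eval_zero]
  have h1 := coeff_diffCoeff η hlt
  rw [hz, coeff_zero, eq_comm, mul_eq_zero, CharP.cast_eq_zero_iff K p] at h1
  exact h1.elim hr hc

end InfiniteField

/-! ### Characters of finite commutative rings -/

lemma AddChar.map_sum_eq_prod {ι A M : Type*} [AddCommMonoid A] [CommMonoid M] (ψ : AddChar A M)
    (s : Finset ι) (f : ι → A) : ψ (∑ i ∈ s, f i) = ∏ i ∈ s, ψ (f i) := by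
  classical
  induction s using Finset.induction_on with
  | empty => simp
  | insert i s hi ih => rw [Finset.prod_insert hi, Finset.sum_insert hi, AddChar.map_add_eq_mul, ih]

open Finset in
/-- Let `S` be a set of `u` such that for every lift `v` of a `q`-th root of `u` over the residue
field `K` the product of the characters `w ↦ θᵢ(v ^ Eᵢ w)` is trivial. Then the elements of `S` come
from the roots of a polynomial over `K`. -/
lemma card_mul_card_le_of_forall_prod_eq_one {A K ι : Type*} [CommRing A] [Fintype A] [Field K]
    (π : A →+* K) (hπ : Function.Surjective π) (I : Finset ι) (θ : ι → AddChar A ℂ) (E : ι → ℕ)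
    (q D : ℕ) (hq : Function.Surjective fun x : K => x ^ q)
    (hθ : ∀ i ∈ I, ∀ w, π w = 0 → θ i w = 1) (hE : ∀ i ∈ I, θ i ≠ 1 → E i ≤ D)
    {i₀ : ι} (hi₀ : i₀ ∈ I) (hθ₀ : θ i₀ ≠ 1) (hE₀ : ∀ i ∈ I, θ i ≠ 1 → E i = E i₀ → i = i₀)
    (S : Finset A) (hS : ∀ u ∈ S, ∀ v, π u = π v ^ q → ∀ w, ∏ i ∈ I, θ i (v ^ E i * w) = 1) :
    #S * Nat.card K ≤ D * Fintype.card A := by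
  classical
  have : Finite K := Finite.of_surjective π hπ
  have := Fintype.ofFinite K
  -- Every character of the finite field `K` is a multiplicative shift of one nontrivial `τ`. Each
  -- `θ i` factors through `K`, hence is `w ↦ τ (κ i * π w)`.
  obtain ⟨τ, hτ⟩ := (AddChar.exists_apply_ne_zero (a := (1 : K))).2 one_ne_zero
  have hτ1 : τ ≠ 1 := AddChar.ne_one_iff.2 ⟨1, hτ⟩
  have hprim := AddChar.IsPrimitive.of_ne_one hτ1
  have hbij : Function.Bijective τ.mulShift := by
    rw [Fintype.bijective_iff_injective_and_card]
    exact ⟨AddChar.to_mulShift_inj_of_isPrimitive hprim, AddChar.card_eq.symm⟩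
  have hκ : ∀ i, ∃ κ : K, i ∈ I → ∀ w, θ i w = τ (κ * π w) := by
    intro i
    by_cases hi : i ∈ I
    swap
    · exact ⟨0, fun h => absurd h hi⟩
    have hwd : ∀ a b, π a = π b → θ i a = θ i b := by
      intro a b hab
      have h1 := hθ i hi (a - b) (by rw [map_sub, hab, sub_self])
      rw [← sub_add_cancel a b, AddChar.map_add_eq_mul, h1, one_mul]
    let χ : AddChar K ℂ :=
      { toFun := fun x => θ i (Function.surjInv hπ x)
        map_zero_eq_one' := by
          rw [hwd _ 0 (by rw [Function.surjInv_eq hπ, map_zero]), AddChar.map_zero_eq_one]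
        map_add_eq_mul' := fun x y => by
          rw [← AddChar.map_add_eq_mul]
          exact hwd _ _ (by simp [Function.surjInv_eq hπ]) }
    obtain ⟨κ, hκ⟩ := hbij.2 χ
    refine ⟨κ, fun _ w => ?_⟩
    rw [← AddChar.mulShift_apply, hκ]
    exact hwd _ _ (by simp [Function.surjInv_eq hπ])
  choose κ hκ using hκ
  have hκ0 : ∀ i ∈ I, κ i ≠ 0 → θ i ≠ 1 := by
    intro i hi h0 h1
    refine hprim h0 ?_
    ext x
    obtain ⟨w, rfl⟩ := hπ x
    rw [AddChar.mulShift_apply, ← hκ i hi, h1]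
    rfl
  -- The product of the `θ i (v ^ E i * w)` equals `τ (F(π v) * π w)`, so its triviality in `w`
  -- forces `F(π v) = 0`. Uniqueness of the exponent `E i₀` prevents cancellation in `F`.
  let F : K[X] := ∑ i ∈ I, monomial (E i) (κ i)
  have hF0 : F ≠ 0 := by
    intro h0
    have h1 : F.coeff (E i₀) = κ i₀ := by
      rw [finsetSum_coeff, Finset.sum_eq_single i₀]
      · simp
      · intro i hi hne
        rw [coeff_monomial]
        split_ifs with h
        · by_contra hk
          exact hne (hE₀ i hi (hκ0 i hi hk) h)
        · rfl
      · exact fun h => absurd hi₀ h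
    rw [h0, coeff_zero] at h1
    apply hθ₀
    ext w
    rw [hκ i₀ hi₀ w, ← h1, zero_mul, AddChar.map_zero_eq_one]
    rfl
  have hFdeg : F.natDegree ≤ D := by
    refine natDegree_sum_le_of_forall_le _ _ fun i hi => ?_
    by_cases hk : κ i = 0
    · simp [hk]
    · exact (natDegree_monomial_le _).trans (hE i hi (hκ0 i hi hk))
  have himg : S.image π ⊆ F.roots.toFinset.image (· ^ q) := by
    intro x hx
    obtain ⟨u, hu, rfl⟩ := Finset.mem_image.1 hx
    obtain ⟨y, hy⟩ := hq (π u)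
    obtain ⟨v, rfl⟩ := hπ y
    refine Finset.mem_image.2 ⟨π v, ?_, hy⟩
    rw [Multiset.mem_toFinset, mem_roots hF0, IsRoot.def]
    by_contra hne
    refine hprim hne ?_
    ext x
    obtain ⟨w, rfl⟩ := hπ x
    have h1 := hS u hu v hy.symm w
    have h2 : ∏ i ∈ I, θ i (v ^ E i * w) = τ (∑ i ∈ I, κ i * (π v ^ E i * π w)) := by
      rw [AddChar.map_sum_eq_prod]
      exact Finset.prod_congr rfl fun i hi => by rw [hκ i hi, map_mul π, map_pow]
    rw [h2] at h1
    rw [AddChar.mulShift_apply, AddChar.one_apply, ← h1]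
    simp only [F, eval_finsetSum, eval_monomial, Finset.sum_mul, mul_assoc]
  have hcard : #(S.image π) ≤ D :=
    (Finset.card_le_card himg).trans <| Finset.card_image_le.trans <|
      (Multiset.toFinset_card_le _).trans <| (card_roots' F).trans hFdeg
  have hker : Fintype.card A = Nat.card K * Nat.card (RingHom.ker π) := by
    have h1 := Submodule.card_eq_card_quotient_mul_card (RingHom.ker π)
    rwa [Nat.card_congr (RingHom.quotientKerEquivOfSurjective hπ).toEquiv, Nat.card_eq_fintype_card,
      mul_comm] at h1
  have hS' : #S ≤ Nat.card (RingHom.ker π) * #(S.image π) := by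
    refine Finset.card_le_mul_card_image S _ fun x hx => ?_
    obtain ⟨u, hu, rfl⟩ := Finset.mem_image.1 hx
    rw [Nat.card_eq_fintype_card, ← Finset.card_univ]
    refine Finset.card_le_card_of_injOn
      (fun a => if h : a - u ∈ RingHom.ker π then ⟨a - u, h⟩ else 0) (fun _ _ => Finset.mem_univ _) ?_
    have hmem : ∀ a ∈ ({x ∈ S | π x = π u} : Finset A), a - u ∈ RingHom.ker π := by
      intro a ha
      rw [RingHom.mem_ker, map_sub, (Finset.mem_filter.1 ha).2, sub_self]
    intro a ha b hb hab
    simp only [dif_pos (hmem a ha), dif_pos (hmem b hb), Subtype.mk.injEq] at hab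
    exact sub_left_injective hab
  calc #S * Nat.card K ≤ Nat.card (RingHom.ker π) * D * Nat.card K := by gcongr; exact hS'.trans (by gcongr)
    _ = D * Fintype.card A := by rw [hker]; ring

/-- A proper ideal of a Noetherian ring has a prime colon ideal by an element. -/
lemma exists_prime_mul_mem_iff {A : Type*} [CommRing A] [IsNoetherianRing A] {J : Ideal A}
    (hJ : J ≠ ⊤) : ∃ (𝔭 : Ideal A) (g : A), 𝔭.IsPrime ∧ ∀ w, w ∈ 𝔭 ↔ g * w ∈ J := by
  have : Nontrivial (A ⧸ J) := Ideal.Quotient.nontrivial_iff.2 hJ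
  obtain ⟨𝔭, h⟩ := associatedPrimes.nonempty A (A ⧸ J)
  obtain ⟨hp, x, hx⟩ := isAssociatedPrime_iff.1 h
  obtain ⟨g, rfl⟩ := Ideal.Quotient.mk_surjective x
  refine ⟨𝔭, g, hp, fun w => ?_⟩
  rw [hx, Submodule.mem_colon_singleton, Submodule.mem_bot, Algebra.smul_def,
    Ideal.Quotient.algebraMap_eq, ← map_mul, Ideal.Quotient.eq_zero_iff_mem, mul_comm]

/-! ### Weyl differencing -/

lemma eq_of_mul_pow_eq_mul_pow {p : ℕ} (hp : p.Prime) {r r' i j : ℕ} (hr : ¬ p ∣ r) (hr' : ¬ p ∣ r')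
    (h : r * p ^ i = r' * p ^ j) : i = j ∧ r = r' := by
  have key : ∀ r r' i j : ℕ, ¬ p ∣ r → r * p ^ i = r' * p ^ j → j ≤ i := by
    intro r r' i j hr h
    by_contra! hij
    obtain ⟨c, rfl⟩ := Nat.exists_eq_add_of_lt hij
    apply hr
    have : r = r' * p ^ (c + 1) := by
      refine Nat.eq_of_mul_eq_mul_right (pow_pos hp.pos i) ?_
      rw [h]
      ring
    rw [this, pow_succ]
    exact ⟨r' * p ^ c, by ring⟩
  obtain rfl : i = j := le_antisymm (key _ _ _ _ hr' h.symm) (key _ _ _ _ hr h)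
  exact ⟨rfl, Nat.eq_of_mul_eq_mul_right (pow_pos hp.pos i) h⟩

/-- Each positive `a` is uniquely `r * p ^ j` with `p ∤ r`. The pairs with product beyond the range
contribute `1`. -/
lemma prod_range_pow_succ_eq {M : Type*} [CommMonoid M] {p : ℕ} (hp : p.Prime) (L : ℕ) (G : ℕ → M)
    (hG : ∀ a, p ^ (L + 1) ≤ a → G a = 1) :
    ∏ a ∈ Finset.range (p ^ (L + 1)), G a = G 0 * ∏ r ∈ Finset.range (p ^ (L + 1)),
      if p ∣ r then 1 else ∏ j ∈ Finset.range (L + 1), G (r * p ^ j) := by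
  rw [← Finset.mul_prod_erase _ _ (Finset.mem_range.2 (pow_pos hp.pos (L + 1)))]
  congr 1
  have h : ∀ r, (if p ∣ r then 1 else ∏ j ∈ Finset.range (L + 1), G (r * p ^ j)) =
      if ¬ p ∣ r then ∏ j ∈ Finset.range (L + 1), G (r * p ^ j) else 1 := fun r => (ite_not ..).symm
  rw [Finset.prod_congr rfl fun r _ => h r, ← Finset.prod_filter, Finset.prod_sigma']
  symm
  refine Finset.prod_bij_ne_one (fun x _ _ => x.1 * p ^ x.2) ?_ ?_ ?_ ?_
  · rintro ⟨r, j⟩ h h1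
    simp only [Finset.mem_sigma, Finset.mem_filter, Finset.mem_range] at h
    rw [Finset.mem_erase, Finset.mem_range]
    constructor
    · have : r ≠ 0 := fun h0 => h.1.2 (h0 ▸ dvd_zero p)
      exact mul_ne_zero this (pow_pos hp.pos _).ne'
    · by_contra hle
      exact h1 (hG _ (not_lt.1 hle))
  · rintro ⟨r, i⟩ h - ⟨r', j⟩ h' - heq
    simp only [Finset.mem_sigma, Finset.mem_filter, Finset.mem_range] at h h' heq
    obtain ⟨rfl, rfl⟩ := eq_of_mul_pow_eq_mul_pow hp h.1.2 h'.1.2 heq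
    rfl
  · intro a ha _
    rw [Finset.mem_erase, Finset.mem_range] at ha
    obtain ⟨j, r, hr, rfl⟩ := Nat.exists_eq_pow_mul_and_not_dvd ha.1 p hp.ne_one
    have hr0 : 0 < r := Nat.pos_of_ne_zero fun h0 => hr (h0 ▸ dvd_zero p)
    have h1 : r < p ^ (L + 1) := lt_of_le_of_lt (Nat.le_mul_of_pos_left _ (pow_pos hp.pos _)) ha.2
    have h2 : j < L + 1 := (Nat.pow_lt_pow_iff_right hp.one_lt).1
      (lt_of_le_of_lt (Nat.le_mul_of_pos_right _ hr0) ha.2)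
    refine ⟨⟨r, j⟩, ?_, ?_, mul_comm _ _⟩
    · simp [hr, h1, h2]
    · rwa [mul_comm]
  · intros
    rfl

/-- The function `y ↦ ∏ᵣ ψᵣ(y ^ r)`. -/
def charProd {A : Type*} [CommRing A] (p L : ℕ) (ψ : ℕ → AddChar A ℂ) (y : A) : ℂ :=
  ∏ r ∈ Finset.range (p ^ (L + 1)), ψ r (y ^ r)

lemma norm_charProd {A : Type*} [CommRing A] [Finite A] (p L : ℕ) (ψ : ℕ → AddChar A ℂ) (y : A) :
    ‖charProd p L ψ y‖ = 1 := by
  rw [charProd, norm_prod]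
  exact Finset.prod_eq_one fun r _ => AddChar.norm_apply _ _

/-! ### Derivatives of products of characters -/

section DiffChar

variable {A : Type*} [CommRing A] (p : ℕ) [Fact p.Prime] [CharP A p]

/-- The character `z ↦ ψ (c z ^ (p ^ j))`. -/
def AddChar.frobeniusTwist (ψ : AddChar A ℂ) (c : A) (j : ℕ) : AddChar A ℂ :=
  ψ.compAddMonoidHom ((AddMonoidHom.mulLeft c).comp (iterateFrobenius A p j : A →+* A))

lemma AddChar.frobeniusTwist_apply (ψ : AddChar A ℂ) (c : A) (j : ℕ) (z : A) :
    ψ.frobeniusTwist p c j z = ψ (c * z ^ p ^ j) := by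
  simp [AddChar.frobeniusTwist, iterateFrobenius_def]

/-- The family of characters of the derivative in direction `u` of `y ↦ ∏ᵣ ψᵣ(y ^ r)`. -/
def diffChar (L : ℕ) (ψ : ℕ → AddChar A ℂ) (u : A) (b : ℕ) : AddChar A ℂ :=
  if p ∣ b then 1 else ∏ j ∈ Finset.range (L + 1), ∏ r ∈ Finset.range (p ^ (L + 1)),
    if b * p ^ j < r then
      (ψ r).frobeniusTwist p (r.choose (b * p ^ j) * u ^ (r - b * p ^ j)) j else 1

/-- In the binomial expansion of `(y + u) ^ r`, the term `a = r` returns `charProd p L ψ y` and `a =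
0` gives the constant. The others regroup by the part of `a` prime to `p`, since `y ^ (b * p ^ j)`
is a Frobenius power of `y ^ b`. -/
lemma charProd_add (L : ℕ) (ψ : ℕ → AddChar A ℂ) (u y : A) :
    charProd p L ψ (y + u) = charProd p L ψ y *
      ((∏ r ∈ Finset.range (p ^ (L + 1)), if 0 < r then ψ r (u ^ r) else 1) *
        charProd p L (diffChar p L ψ u) y) := by
  have hp : p.Prime := Fact.out
  let G : ℕ → ℂ := fun a => ∏ r ∈ Finset.range (p ^ (L + 1)),
    if a < r then ψ r (r.choose a * u ^ (r - a) * y ^ a) else 1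
  have h1 : charProd p L ψ (y + u) =
      charProd p L ψ y * ∏ a ∈ Finset.range (p ^ (L + 1)), G a := by
    rw [Finset.prod_comm, charProd, charProd, ← Finset.prod_mul_distrib]
    refine Finset.prod_congr rfl fun r hr => ?_
    rw [add_pow, Finset.sum_range_succ, AddChar.map_add_eq_mul, mul_comm]
    congr 1
    · simp
    · rw [AddChar.map_sum_eq_prod, ← Finset.prod_filter]
      refine Finset.prod_congr ?_ fun a _ => by congr 1; ring
      ext a
      rw [Finset.mem_range] at hr
      simp only [Finset.mem_range, Finset.mem_filter]
      omega
  have hG : ∀ a, p ^ (L + 1) ≤ a → G a = 1 := by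
    intro a ha
    refine Finset.prod_eq_one fun r hr => ?_
    rw [Finset.mem_range] at hr
    rw [if_neg (by omega)]
  rw [h1, prod_range_pow_succ_eq hp L G hG]
  congr 2
  · simp [G]
  · refine Finset.prod_congr rfl fun b _ => ?_
    rw [diffChar]
    split_ifs
    · rfl
    · rw [AddChar.prod_apply]
      refine Finset.prod_congr rfl fun j _ => ?_
      rw [AddChar.prod_apply]
      refine Finset.prod_congr rfl fun r _ => ?_
      split_ifs
      · rw [AddChar.frobeniusTwist_apply, ← pow_mul]
      · rfl

/-- A nontrivial factor needs `p ∤ r.choose (b * p ^ j)`. Then the digit sums of `b` and of the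
positive number `r - b * p ^ j` add up to at most that of `r`. -/
lemma diffChar_support {L k : ℕ} {ψ : ℕ → AddChar A ℂ}
    (hψ : ∀ r, ψ r ≠ 1 → ¬ p ∣ r ∧ digitSum p r ≤ k + 1 ∧ r < p ^ (L + 1)) (u : A) {b : ℕ}
    (hb : diffChar p L ψ u b ≠ 1) : ¬ p ∣ b ∧ digitSum p b ≤ k ∧ b < p ^ (L + 1) := by
  have hp : p.Prime := Fact.out
  rw [diffChar] at hb
  split_ifs at hb with hpb
  · exact absurd rfl hb
  obtain ⟨j, hj, hb⟩ := Finset.exists_ne_one_of_prod_ne_one hb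
  obtain ⟨r, hr, hb⟩ := Finset.exists_ne_one_of_prod_ne_one hb
  split_ifs at hb with hlt
  swap
  · exact absurd rfl hb
  have hψr : ψ r ≠ 1 := by
    rintro h
    apply hb
    ext z
    rw [AddChar.frobeniusTwist_apply, h]
    rfl
  have hc : ¬ p ∣ r.choose (b * p ^ j) := by
    intro h
    apply hb
    ext z
    rw [AddChar.frobeniusTwist_apply, (CharP.cast_eq_zero_iff A p _).2 h]
    simp
  have h1 := digitSum_add_le_of_not_dvd_choose hp hlt.le hc
  have h2 := digitSum_pos hp.one_lt (Nat.sub_pos_of_lt hlt)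
  rw [digitSum_mul_pow hp.one_lt] at h1
  obtain ⟨-, h3, h4⟩ := hψ r hψr
  refine ⟨hpb, by omega, ?_⟩
  exact lt_of_le_of_lt (Nat.le_mul_of_pos_right b (pow_pos hp.pos j)) (hlt.trans h4)

open Classical Finset in
/-- For all but few `u`, the derivative in direction `u` still has a nontrivial character at the
top digit sum. -/
lemma exists_card_diffChar_eq_one_le [Fintype A] {L k N : ℕ}
    (hN : ∀ 𝔭 : Ideal A, 𝔭.IsPrime → N ≤ Nat.card (A ⧸ 𝔭)) {ψ : ℕ → AddChar A ℂ}
    (hψ : ∀ r, ψ r ≠ 1 → ¬ p ∣ r ∧ digitSum p r ≤ k + 2 ∧ r < p ^ (L + 1))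
    (hψ0 : ∃ r, ψ r ≠ 1 ∧ digitSum p r = k + 2) :
    ∃ b, digitSum p b = k + 1 ∧
      #{u : A | diffChar p L ψ u b = 1} * N ≤ p ^ (2 * L) * Fintype.card A := by
  have hp : p.Prime := Fact.out
  -- The largest ideal on which all top characters are trivial. With `𝔭 = (J : g)`, the substitution
  -- `w ↦ g * w` makes these characters factor through the field `A ⧸ 𝔭`, even when `A` is not
  -- reduced.
  let J : Ideal A :=
    { carrier := {z | ∀ r, digitSum p r = k + 2 → ∀ w, ψ r (z * w) = 1}
      add_mem' := fun {x y} hx hy r hr w => by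
        rw [add_mul, AddChar.map_add_eq_mul, hx r hr, hy r hr, one_mul]
      zero_mem' := fun r _ w => by rw [zero_mul, AddChar.map_zero_eq_one]
      smul_mem' := fun c x hx r hr w => by
        rw [smul_eq_mul, mul_comm c, mul_assoc]
        exact hx r hr _ }
  have hJdef : ∀ z, z ∈ J ↔ ∀ r, digitSum p r = k + 2 → ∀ w, ψ r (z * w) = 1 := fun z => Iff.rfl
  have hJ : J ≠ ⊤ := by
    obtain ⟨r, hr, hs⟩ := hψ0
    rw [Ideal.ne_top_iff_one, hJdef]
    intro h
    apply hr
    ext w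
    have := h r hs w
    rwa [one_mul] at this
  obtain ⟨𝔭, g, h𝔭, hg⟩ := exists_prime_mul_mem_iff hJ
  have hgJ : g ∉ J := by
    intro h
    apply h𝔭.ne_top
    rw [Ideal.eq_top_iff_one, hg, mul_one]
    exact h
  obtain ⟨r₀, hr₀, w₀, hw₀⟩ : ∃ r, digitSum p r = k + 2 ∧ ∃ w, ψ r (g * w) ≠ 1 := by
    rw [hJdef] at hgJ
    push Not at hgJ
    exact hgJ
  have hψr₀ : ψ r₀ ≠ 1 := fun h => hw₀ (by rw [h]; rfl)
  obtain ⟨hpr₀, -, hlt₀⟩ := hψ r₀ hψr₀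
  have hr₀pos : 0 < r₀ := Nat.pos_of_ne_zero fun h => hpr₀ (h ▸ dvd_zero p)
  obtain ⟨e, he, hs, hd, hc⟩ := exists_lower_digitSum hp hr₀pos
  set b := r₀ - p ^ e with hbdef
  have hpb : ¬ p ∣ b := hd (by omega) hpr₀
  have hsb : digitSum p b = k + 1 := by omega
  refine ⟨b, hsb, ?_⟩
  refine le_trans (Nat.mul_le_mul_left _ (hN 𝔭 h𝔭)) ?_
  have hfin : Finite (A ⧸ 𝔭) := inferInstance
  let _ : Field (A ⧸ 𝔭) := IsField.toField (Finite.isField_of_domain (A ⧸ 𝔭))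
  have hchar : CharP (A ⧸ 𝔭) p := by
    rw [CharP.charP_iff_prime_eq_zero hp, ← map_natCast (Ideal.Quotient.mk 𝔭), CharP.cast_eq_zero,
      map_zero]
  -- Finite fields are perfect. Setting `u = v ^ p ^ L` modulo `𝔭` makes every power of `u` a `p ^
  -- j`-th power for `j ≤ L`.
  have hq : Function.Surjective fun x : A ⧸ 𝔭 => x ^ p ^ L := by
    have h1 : Function.Injective (iterateFrobenius (A ⧸ 𝔭) p L) := RingHom.injective _
    have h2 := Finite.surjective_of_injective h1
    intro x
    obtain ⟨y, hy⟩ := h2 x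
    exact ⟨y, by rw [← hy, iterateFrobenius_def]⟩
  let I : Finset (ℕ × ℕ) := {x ∈ range (L + 1) ×ˢ range (p ^ (L + 1)) |
    b * p ^ x.1 < x.2 ∧ digitSum p x.2 = k + 2}
  let θ : ℕ × ℕ → AddChar A ℂ := fun x =>
    (ψ x.2).frobeniusTwist p (x.2.choose (b * p ^ x.1) * g ^ p ^ x.1) x.1
  -- Chosen so that `(v ^ E x) ^ p ^ j = (v ^ p ^ L) ^ (r - b * p ^ j)` for `x = (j, r)`.
  let E : ℕ × ℕ → ℕ := fun x => (x.2 - b * p ^ x.1) * p ^ (L - x.1)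
  have hθapp : ∀ x w, θ x w = ψ x.2 (x.2.choose (b * p ^ x.1) * (g * w) ^ p ^ x.1) := by
    intro x w
    rw [AddChar.frobeniusTwist_apply, mul_pow, mul_assoc]
  have hI : ∀ x ∈ I, x.1 ≤ L ∧ x.2 < p ^ (L + 1) ∧ b * p ^ x.1 < x.2 ∧ digitSum p x.2 = k + 2 := by
    intro x hx
    simp only [I, mem_filter, mem_product, mem_range] at hx
    exact ⟨by omega, hx.1.2, hx.2.1, hx.2.2⟩
  have hJψ : ∀ r, digitSum p r = k + 2 → ∀ z ∈ J, ψ r z = 1 := by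
    intro r hr z hz
    have := (hJdef z).1 hz r hr 1
    rwa [mul_one] at this
  -- the exponents in the nontrivial terms
  have hne : ∀ x ∈ I, θ x ≠ 1 → ¬ p ∣ x.2 ∧ ∃ i, x.2 = b * p ^ x.1 + p ^ i := by
    intro x hx h
    obtain ⟨-, -, hlt, hsx⟩ := hI x hx
    have hψx : ψ x.2 ≠ 1 := by
      rintro h1
      apply h
      ext w
      rw [hθapp, h1]
      rfl
    have hcx : ¬ p ∣ x.2.choose (b * p ^ x.1) := by
      intro h1
      apply h
      ext w
      rw [hθapp, (CharP.cast_eq_zero_iff A p _).2 h1]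
      simp
    have h1 := digitSum_add_le_of_not_dvd_choose hp hlt.le hcx
    have h2 := digitSum_pos hp.one_lt (Nat.sub_pos_of_lt hlt)
    rw [digitSum_mul_pow hp.one_lt] at h1
    obtain ⟨i, hi⟩ := exists_eq_pow_of_digitSum_eq_one hp.one_lt
      (n := x.2 - b * p ^ x.1) (by omega)
    exact ⟨(hψ _ hψx).1, i, by omega⟩
  refine card_mul_card_le_of_forall_prod_eq_one (Ideal.Quotient.mk 𝔭) Ideal.Quotient.mk_surjective
    I θ E (p ^ L) (p ^ (2 * L)) hq ?_ ?_ (i₀ := (0, r₀)) ?_ ?_ ?_ _ ?_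
  · intro x hx w hw
    rw [Ideal.Quotient.eq_zero_iff_mem, hg] at hw
    rw [hθapp]
    exact hJψ _ (hI x hx).2.2.2 _ (J.mul_mem_left _ (J.pow_mem_of_mem hw _ (pow_pos hp.pos _)))
  -- Here `r = b * p ^ j + p ^ i` with `i ≤ L`, so `E x = p ^ (i + L - j)`, at most `p ^ (2 * L)`.
  · intro x hx h
    obtain ⟨-, i, hi⟩ := hne x hx h
    have h1 : i < L + 1 := by
      refine (Nat.pow_lt_pow_iff_right hp.one_lt).1 (lt_of_le_of_lt ?_ (hI x hx).2.1)
      omega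
    have h2 : E x = p ^ (i + (L - x.1)) := by
      simp only [E]
      rw [hi, Nat.add_sub_cancel_left, pow_add]
    rw [h2]
    exact Nat.pow_le_pow_right hp.pos (by omega)
  · simp only [I, mem_filter, mem_product, mem_range, pow_zero, mul_one]
    exact ⟨⟨by omega, hlt₀⟩, Nat.sub_lt hr₀pos (pow_pos hp.pos _), hr₀⟩
  · intro h
    have hu : IsUnit ((r₀.choose b : ℕ) : A) := by
      rw [CharP.isUnit_natCast_iff hp]
      exact hc
    obtain ⟨c, hcu⟩ := hu.exists_right_inv
    apply hw₀
    have h1 : θ (0, r₀) (c * w₀) = 1 := by rw [h]; rfl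
    rw [hθapp] at h1
    simp only [pow_zero, mul_one, pow_one] at h1
    rwa [show (r₀.choose b : A) * (g * (c * w₀)) = (r₀.choose b * c) * (g * w₀) by ring, hcu,
      one_mul] at h1
  -- Equal exponents force `i = e + j`. If `j > 0`, then `p` divides both summands of `r`,
  -- contradicting `p ∤ r`.
  · rintro ⟨j, r⟩ hx h hE
    obtain ⟨hpr, i, hi⟩ := hne _ hx h
    simp only [E] at hE hpr hi
    rw [hi, Nat.add_sub_cancel_left, pow_zero, mul_one, Nat.sub_zero, hbdef,
      Nat.sub_sub_self he, ← pow_add, ← pow_add] at hE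
    have hE' := Nat.pow_right_injective hp.two_le hE
    rcases Nat.eq_zero_or_pos j with rfl | hj
    · obtain rfl : i = e := by omega
      rw [pow_zero, mul_one] at hi
      rw [hi, hbdef, Nat.sub_add_cancel he]
    · exfalso
      rcases Nat.eq_zero_or_pos i with rfl | hi0
      · have := (hI _ hx).1
        simp only at this
        omega
      · apply hpr
        rw [hi]
        exact dvd_add ((dvd_pow_self p hj.ne').mul_left _) (dvd_pow_self p hi0.ne')
  · intro u hu v huv w
    rw [Finset.mem_filter] at hu
    have h1 : diffChar p L ψ u b (g * w) = 1 := by rw [hu.2]; rfl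
    rw [diffChar, if_neg hpb, AddChar.prod_apply] at h1
    simp only [AddChar.prod_apply] at h1
    rw [← Finset.prod_product'] at h1
    rw [← h1, Finset.prod_filter]
    refine Finset.prod_congr rfl fun x hx => ?_
    by_cases hlt : b * p ^ x.1 < x.2
    swap
    · rw [if_neg (fun h => hlt h.1), if_neg hlt, AddChar.one_apply]
    rw [if_pos hlt]
    by_cases hsx : digitSum p x.2 = k + 2
    · rw [if_pos ⟨hlt, hsx⟩, hθapp, AddChar.frobeniusTwist_apply, ← sub_eq_zero]
      have hxL : x.1 ≤ L := by
        rw [mem_product, mem_range] at hx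
        omega
      set D := x.2 - b * p ^ x.1 with hD
      have h2 : v ^ p ^ L - u ∈ 𝔭 := by
        rw [← Ideal.Quotient.eq_zero_iff_mem, map_sub, map_pow, huv, sub_self]
      have h3 : (v ^ p ^ L) ^ D - u ^ D ∈ 𝔭 := 𝔭.mem_of_dvd (sub_dvd_pow_sub_pow _ _ _) h2
      -- One factor `g` of `g ^ p ^ j` suffices, because `g * 𝔭 ⊆ J`.
      have h4 : (x.2.choose (b * p ^ x.1) : A) * (g * (v ^ E x * w)) ^ p ^ x.1 -
          x.2.choose (b * p ^ x.1) * u ^ D * (g * w) ^ p ^ x.1 ∈ J := by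
        have h5 : (v ^ E x) ^ p ^ x.1 = (v ^ p ^ L) ^ D := by
          rw [← pow_mul, ← pow_mul]
          congr 1
          simp only [E]
          rw [mul_assoc, ← pow_add, Nat.sub_add_cancel hxL, mul_comm]
        have h6 : g ^ p ^ x.1 = g * g ^ (p ^ x.1 - 1) := by
          rw [← pow_succ', Nat.sub_add_cancel (pow_pos hp.pos _)]
        have h7 : (x.2.choose (b * p ^ x.1) : A) * (g * (v ^ E x * w)) ^ p ^ x.1 -
            x.2.choose (b * p ^ x.1) * u ^ D * (g * w) ^ p ^ x.1 =
            (x.2.choose (b * p ^ x.1) * g ^ (p ^ x.1 - 1) * w ^ p ^ x.1) *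
              (g * ((v ^ p ^ L) ^ D - u ^ D)) := by
          rw [mul_pow, mul_pow, mul_pow, h5, h6]
          ring
        rw [h7]
        exact J.mul_mem_left _ ((hg _).1 h3)
      have h8 := hJψ _ hsx _ h4
      rw [AddChar.map_sub_eq_div, div_eq_one_iff_eq
        (AddChar.val_isUnit _ _).ne_zero] at h8
      rw [h8, sub_self]
    -- Below the top digit sum, a nontrivial `ψ r` cannot reach `b`: its binomial coefficient
    -- vanishes modulo `p`.
    · rw [if_neg (fun h => hsx h.2), AddChar.frobeniusTwist_apply]
      by_cases hψx : ψ x.2 = 1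
      · rw [hψx, AddChar.one_apply]
      · have hle := (hψ _ hψx).2.1
        have hcx : p ∣ x.2.choose (b * p ^ x.1) := by
          by_contra hcx
          have h1 := digitSum_add_le_of_not_dvd_choose hp hlt.le hcx
          have h2 := digitSum_pos hp.one_lt (Nat.sub_pos_of_lt hlt)
          rw [digitSum_mul_pow hp.one_lt] at h1
          omega
        rw [(CharP.cast_eq_zero_iff A p _).2 hcx]
        simp

end DiffChar

/-! ### The Weyl inequality -/

section Weyl

open ComplexConjugate

lemma norm_sum_sq_le {A : Type*} [AddCommGroup A] [Fintype A] (φ : A → ℂ) :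
    ‖∑ y, φ y‖ ^ 2 ≤ ∑ u, ‖∑ y, φ (y + u) * conj (φ y)‖ := by
  have h : (∑ y, φ y) * conj (∑ y, φ y) = ∑ u, ∑ y, φ (y + u) * conj (φ y) := by
    rw [map_sum, Finset.sum_mul_sum, Finset.sum_comm, Finset.sum_comm (s := Finset.univ)]
    conv_rhs => rw [Finset.sum_comm]
    rw [Finset.sum_comm]
    refine Finset.sum_congr rfl fun y _ => ?_
    exact (Equiv.sum_comp (Equiv.addLeft y) fun x => φ x * conj (φ y)).symm
  calc ‖∑ y, φ y‖ ^ 2 = ‖(∑ y, φ y) * conj (∑ y, φ y)‖ := by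
        rw [norm_mul, RCLike.norm_conj, sq]
    _ ≤ _ := by
        rw [h]
        exact norm_sum_le _ _

variable {A : Type*} [CommRing A] [Fintype A] (p : ℕ) [Fact p.Prime] [CharP A p]

open Classical Finset in
theorem norm_sum_charProd_le {L N : ℕ} (hN0 : 0 < N)
    (hN : ∀ 𝔭 : Ideal A, 𝔭.IsPrime → N ≤ Nat.card (A ⧸ 𝔭)) (k : ℕ) :
    ∀ ψ : ℕ → AddChar A ℂ,
      (∀ r, ψ r ≠ 1 → ¬ p ∣ r ∧ digitSum p r ≤ k + 1 ∧ r < p ^ (L + 1)) →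
      (∃ r, ψ r ≠ 1 ∧ digitSum p r = k + 1) →
      (‖∑ y, charProd p L ψ y‖ / Fintype.card A) ^ 2 ^ k ≤ (p : ℝ) ^ (2 * L) * (k / N) := by
  have hp : p.Prime := Fact.out
  have hA : (0 : ℝ) < Fintype.card A := by exact_mod_cast Fintype.card_pos
  have hN' : (0 : ℝ) < N := by exact_mod_cast hN0
  induction k with
  | zero =>
    intro ψ hψ ⟨r, hr, hs⟩
    have key : ∀ r, ψ r ≠ 1 → r = 1 := by
      intro r hr
      obtain ⟨h1, h2, -⟩ := hψ r hr
      have h3 : 0 < r := Nat.pos_of_ne_zero fun h => h1 (h ▸ dvd_zero p)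
      have h4 := digitSum_pos hp.one_lt h3
      obtain ⟨e, rfl⟩ := exists_eq_pow_of_digitSum_eq_one hp.one_lt (n := r) (by omega)
      rcases Nat.eq_zero_or_pos e with rfl | he
      · simp
      · exact absurd (dvd_pow_self p he.ne') h1
    obtain rfl := key r hr
    have h1 : ∀ y, charProd p L ψ y = ψ 1 y := by
      intro y
      rw [charProd, Finset.prod_eq_single 1]
      · simp
      · intro b _ hb
        by_cases h : ψ b = 1
        · rw [h, AddChar.one_apply]
        · exact absurd (key b h) hb
      · intro h
        rw [Finset.mem_range] at h
        exact absurd (hψ 1 hr).2.2 h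
    simp only [h1]
    rw [AddChar.sum_eq_zero_of_ne_one hr]
    simp
  | succ k ih =>
    intro ψ hψ hψ0
    obtain ⟨b, hb, hcard⟩ := exists_card_diffChar_eq_one_le p hN hψ hψ0
    set X : A → ℝ := fun u => ‖∑ y, charProd p L (diffChar p L ψ u) y‖ with hX
    have hX1 : ∀ u, X u ≤ Fintype.card A := by
      intro u
      refine (norm_sum_le _ _).trans ?_
      simp [norm_charProd]
    have hsq : ‖∑ y, charProd p L ψ y‖ ^ 2 ≤ ∑ u, X u := by
      refine (norm_sum_sq_le _).trans (Finset.sum_le_sum fun u _ => ?_)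
      set c : ℂ := ∏ r ∈ Finset.range (p ^ (L + 1)), if 0 < r then ψ r (u ^ r) else 1 with hc
      have hc1 : ‖c‖ = 1 := by
        rw [hc, norm_prod]
        refine Finset.prod_eq_one fun r _ => ?_
        split_ifs
        · exact AddChar.norm_apply _ _
        · exact norm_one
      have h1 : ∀ y, charProd p L ψ (y + u) * conj (charProd p L ψ y) =
          c * charProd p L (diffChar p L ψ u) y := by
        intro y
        rw [charProd_add, ← hc, mul_comm, ← mul_assoc, mul_comm (conj _), Complex.mul_conj,
          Complex.normSq_eq_norm_sq, norm_charProd]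
        simp
      simp only [h1]
      rw [← Finset.mul_sum, norm_mul, hc1, one_mul]
    -- Convexity of `x ↦ x ^ 2 ^ k` moves the power inside the average over `u`.
    have hpow : (‖∑ y, charProd p L ψ y‖ / Fintype.card A) ^ 2 ^ (k + 1) ≤
        (∑ u, (X u / Fintype.card A) ^ 2 ^ k) / Fintype.card A := by
      have h1 : (‖∑ y, charProd p L ψ y‖ / Fintype.card A) ^ 2 ≤
          ∑ u, (Fintype.card A : ℝ)⁻¹ * (X u / Fintype.card A) := by
        rw [← Finset.mul_sum, ← Finset.sum_div, div_pow, inv_mul_eq_div, div_div, ← sq]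
        gcongr
      rw [pow_succ' 2 k, pow_mul]
      refine (pow_le_pow_left₀ (sq_nonneg _) h1 _).trans ?_
      refine (Real.pow_arith_mean_le_arith_mean_pow _ _ _ (fun _ _ => by positivity) ?_
        (fun _ _ => by positivity) _).trans ?_
      · simp [hA.ne']
      · rw [← Finset.mul_sum, inv_mul_eq_div]
    refine hpow.trans ?_
    have hbad : ((#{u : A | diffChar p L ψ u b = 1} : ℕ) : ℝ) ≤
        (p : ℝ) ^ (2 * L) / N * Fintype.card A := by
      rw [div_mul_eq_mul_div, le_div_iff₀ hN']
      exact_mod_cast hcard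
    -- Exceptional `u` get the trivial bound `1`; the rest satisfy the induction hypothesis.
    have hterm : ∀ u, (X u / Fintype.card A) ^ 2 ^ k ≤
        (if diffChar p L ψ u b = 1 then 1 else 0) + (p : ℝ) ^ (2 * L) * (k / N) := by
      intro u
      split_ifs with hu
      · have h1 : (X u / Fintype.card A) ^ 2 ^ k ≤ 1 :=
          pow_le_one₀ (by positivity) ((div_le_one hA).2 (hX1 u))
        have h2 : 0 ≤ (p : ℝ) ^ (2 * L) * (k / N) := by positivity
        linarith
      · rw [zero_add]
        exact ih _ (fun r hr => diffChar_support p hψ u hr) ⟨b, hu, hb⟩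
    rw [div_le_iff₀ hA]
    refine (Finset.sum_le_sum fun u _ => hterm u).trans ?_
    rw [Finset.sum_add_distrib, Finset.sum_boole, Finset.sum_const, Finset.card_univ, nsmul_eq_mul]
    have h3 : (p : ℝ) ^ (2 * L) * (((k + 1 : ℕ) : ℝ) / N) * Fintype.card A =
        (p : ℝ) ^ (2 * L) / N * Fintype.card A +
          Fintype.card A * ((p : ℝ) ^ (2 * L) * (k / N)) := by
      push_cast
      ring
    rw [h3]
    gcongr

end Weyl

/-! ### Convolution operators on `L²` of a finite abelian group -/

section Fourier

open ComplexConjugate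

lemma L2norm_eq_sqrt_sum {G : Type*} [Fintype G] (f : G → ℂ) :
    L2norm f = Real.sqrt ((Fintype.card G : ℝ)⁻¹ * ∑ x, ‖f x‖ ^ 2) := by
  rw [L2norm, avg, finsum_mem_univ, finsum_eq_sum_of_fintype, Set.ncard_univ,
    Nat.card_eq_fintype_card, one_div]

variable {G V : Type*} [AddCommGroup G] [Fintype G] [Fintype V]

open Classical in
lemma AddChar.sum_mul_conj (χ χ' : AddChar G ℂ) :
    ∑ x, χ x * conj (χ' x) = if χ = χ' then (Fintype.card G : ℂ) else 0 := by
  have h : ∀ x, χ x * conj (χ' x) = (χ - χ') x := fun x => by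
    rw [AddChar.sub_apply, AddChar.map_neg_eq_conj]
  simp only [h]
  rw [AddChar.sum_eq_ite]
  simp only [sub_eq_zero]

lemma sum_norm_sq_sum_addChar (c : AddChar G ℂ → ℂ) :
    ∑ x, ‖∑ χ, c χ * χ x‖ ^ 2 = Fintype.card G * ∑ χ, ‖c χ‖ ^ 2 := by
  classical
  have h : ((∑ x, ‖∑ χ, c χ * χ x‖ ^ 2 : ℝ) : ℂ) =
      ((Fintype.card G * ∑ χ, ‖c χ‖ ^ 2 : ℝ) : ℂ) := by
    push_cast
    simp only [← Complex.mul_conj', map_sum, map_mul, Finset.sum_mul_sum]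
    rw [Finset.sum_comm, Finset.mul_sum]
    refine Finset.sum_congr rfl fun χ _ => ?_
    rw [Finset.sum_comm]
    have h1 : ∀ χ' : AddChar G ℂ, ∑ x, c χ * χ x * (conj (c χ') * conj (χ' x)) =
        c χ * conj (c χ') * if χ = χ' then (Fintype.card G : ℂ) else 0 := by
      intro χ'
      rw [← AddChar.sum_mul_conj, Finset.mul_sum]
      exact Finset.sum_congr rfl fun x _ => by ring
    simp only [h1]
    simp [mul_comm]
  exact_mod_cast h

/-- Characters diagonalize the operator, with eigenvalue `∑ v, μ v * χ (s v)` at `χ`; Parseval does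
the rest. -/
theorem L2norm_sum_mul_comp_add_le (μ : V → ℂ) (s : V → G) {B : ℝ} (hB0 : 0 ≤ B)
    (hB : ∀ χ : AddChar G ℂ, ‖∑ v, μ v * χ (s v)‖ ≤ B) (f : G → ℂ) :
    L2norm (fun x => ∑ v, μ v * f (x + s v)) ≤ B * L2norm f := by
  obtain ⟨c, rfl⟩ : ∃ c : AddChar G ℂ → ℂ, f = fun x => ∑ χ, c χ * χ x := by
    refine ⟨fun χ => (AddChar.complexBasis G).repr f χ, ?_⟩
    conv_lhs => rw [← (AddChar.complexBasis G).sum_repr f]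
    ext x
    simp [AddChar.complexBasis_apply]
  have h : ∀ x, ∑ v, μ v * ∑ χ : AddChar G ℂ, c χ * χ (x + s v) =
      ∑ χ : AddChar G ℂ, (c χ * ∑ v, μ v * χ (s v)) * χ x := by
    intro x
    simp only [Finset.mul_sum, Finset.sum_mul]
    rw [Finset.sum_comm]
    refine Finset.sum_congr rfl fun χ _ => Finset.sum_congr rfl fun v _ => ?_
    rw [AddChar.map_add_eq_mul]
    ring
  simp only [h]
  rw [L2norm_eq_sqrt_sum, L2norm_eq_sqrt_sum, sum_norm_sq_sum_addChar, sum_norm_sq_sum_addChar]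
  have hG : (Fintype.card G : ℝ) ≠ 0 := by exact_mod_cast Fintype.card_ne_zero
  rw [inv_mul_cancel_left₀ hG, inv_mul_cancel_left₀ hG, ← Real.sqrt_sq hB0,
    ← Real.sqrt_mul (sq_nonneg B)]
  refine Real.sqrt_le_sqrt ?_
  rw [Finset.mul_sum]
  refine Finset.sum_le_sum fun χ _ => ?_
  rw [norm_mul, mul_pow, mul_comm]
  gcongr
  exact hB χ

end Fourier

/-! ### The residue rings `𝔽[t]_Q` -/

section Residue

variable {F : Type*} [Field F] [Finite F] {Q : F[X]}

/-- The preimage of `𝔭` in `F[X]` is generated by an irreducible factor of `Q`. Its existence also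
rules out the default value `0` of `lpf`. -/
lemma lpf_le_card_quotient (hQ : Q.Monic) (𝔭 : Ideal (QuotRing Q)) (h𝔭 : 𝔭.IsPrime) :
    0 < lpf Q ∧ lpf Q ≤ Nat.card (QuotRing Q ⧸ 𝔭) := by
  classical
  set π := Ideal.Quotient.mk (Ideal.span {Q}) with hπ
  set I : Ideal F[X] := 𝔭.comap π with hI
  have hIp : I.IsPrime := Ideal.comap_isPrime π 𝔭
  obtain ⟨R₀, hR₀⟩ := (IsPrincipalIdealRing.principal I).principal
  rw [Ideal.submodule_span_eq] at hR₀
  have hQI : Q ∈ I := by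
    rw [hI, Ideal.mem_comap, hπ, Ideal.Quotient.eq_zero_iff_mem.2 (Ideal.mem_span_singleton_self Q)]
    exact 𝔭.zero_mem
  have hR₀Q : R₀ ∣ Q := by rwa [hR₀, Ideal.mem_span_singleton] at hQI
  have hR₀0 : R₀ ≠ 0 := by
    rintro rfl
    exact hQ.ne_zero (zero_dvd_iff.1 hR₀Q)
  have hR₀p : Prime R₀ := by
    rw [← Ideal.span_singleton_prime hR₀0, ← hR₀]
    exact hIp
  have hassoc : Associated R₀ (normalize R₀) := (normalize_associated R₀).symm
  have hmonic : (normalize R₀).Monic := monic_normalize hR₀0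
  have hcard : Nat.card (QuotRing Q ⧸ 𝔭) = Nat.card F ^ (normalize R₀).natDegree := by
    have e1 : Nat.card (F[X] ⧸ I) = Nat.card (QuotRing Q ⧸ 𝔭) := by
      refine Nat.card_congr (Equiv.ofBijective (Ideal.quotientMap 𝔭 π le_rfl) ⟨?_, ?_⟩)
      · exact Ideal.quotientMap_injective
      · exact Ideal.quotientMap_surjective Ideal.Quotient.mk_surjective
    have hspan : I = Ideal.span {normalize R₀} := by
      rw [hR₀, Ideal.span_singleton_eq_span_singleton]
      exact hassoc
    have := Fintype.ofFinite F
    have hm : Module.Finite F (F[X] ⧸ Ideal.span {normalize R₀}) := hmonic.finite_quotient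
    rw [← e1, hspan, Module.natCard_eq_pow_finrank (K := F),
      finrank_quotient_span_eq_natDegree]
  have hmem : Nat.card (QuotRing Q ⧸ 𝔭) ∈ {N : ℕ | ∃ R : F[X], R.Monic ∧ Irreducible R ∧ R ∣ Q ∧
      N = Nat.card F ^ R.natDegree} :=
    ⟨normalize R₀, hmonic, hassoc.irreducible hR₀p.irreducible, hassoc.symm.dvd.trans hR₀Q, hcard⟩
  refine ⟨?_, Nat.sInf_le hmem⟩
  obtain ⟨R, -, -, -, h⟩ := Nat.sInf_mem ⟨_, hmem⟩
  rw [lpf, h]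
  exact pow_pos Nat.card_pos _

end Residue

/-! ### Polynomials of the form `a₀ + ∑ᵢ ηᵢ(y ^ rᵢ)` -/

section Decomposition

variable {F : Type*} [Field F]

lemma toLaurentAtInfty_injective : Function.Injective (toLaurentAtInfty F) := by
  let : DecidableEq (RatFunc F) := Classical.decEq _
  exact (RingHom.injective (algebraMap (RatFunc F) (RatFunc.CompletionAtInfty F))).comp
    (RatFunc.algebraMap_injective F)

instance : Infinite (LaurentAtInfty F) :=
  Infinite.of_injective _ (toLaurentAtInfty_injective (F := F))

lemma charP_laurentAtInfty (p : ℕ) [CharP F p] : CharP (LaurentAtInfty F) p :=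
  charP_of_injective_ringHom (f := (toLaurentAtInfty F).comp C)
    (toLaurentAtInfty_injective.comp C_injective) p

lemma eval_add_of_isAdditivePoly_map {η : F[X][X]}
    (hη : IsAdditivePoly (η.map (toLaurentAtInfty F))) (x y : F[X]) :
    η.eval (x + y) = η.eval x + η.eval y := by
  apply toLaurentAtInfty_injective
  have := hη (toLaurentAtInfty F x) (toLaurentAtInfty F y)
  rw [← map_add, eval_map_apply, eval_map_apply, eval_map_apply, ← map_add] at this
  exact this

/-- The additive map induced by an additive polynomial on `𝔽[t]_Q`. -/
def additivePolyHom {η : F[X][X]} (hη : IsAdditivePoly (η.map (toLaurentAtInfty F))) (Q : F[X]) :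
    QuotRing Q →+ QuotRing Q :=
  AddMonoidHom.mk' (fun z => aeval z η) <| by
    intro a b
    obtain ⟨x, rfl⟩ := Ideal.Quotient.mk_surjective a
    obtain ⟨y, rfl⟩ := Ideal.Quotient.mk_surjective b
    rw [← map_add, ← Ideal.Quotient.algebraMap_eq, aeval_algebraMap_apply, aeval_algebraMap_apply,
      aeval_algebraMap_apply, ← map_add]
    simp only [coe_aeval_eq_eval]
    rw [eval_add_of_isAdditivePoly_map hη]

lemma additivePolyHom_apply {η : F[X][X]} (hη : IsAdditivePoly (η.map (toLaurentAtInfty F)))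
    (Q : F[X]) (z : QuotRing Q) : additivePolyHom hη Q z = aeval z η := rfl

lemma additivePolyHom_mk {η : F[X][X]} (hη : IsAdditivePoly (η.map (toLaurentAtInfty F)))
    (Q : F[X]) (y : F[X]) : additivePolyHom hη Q (Ideal.Quotient.mk (Ideal.span {Q}) y) =
      Ideal.Quotient.mk (Ideal.span {Q}) (η.eval y) := by
  rw [additivePolyHom_apply, ← Ideal.Quotient.algebraMap_eq, aeval_algebraMap_apply,
    coe_aeval_eq_eval]

variable {p : ℕ} [CharP F p] {P : F[X][X]} {a₀ : F[X]} {n : ℕ} {η : Fin n → F[X][X]} {r : Fin n → ℕ}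

/-- The exponents in `η i (y ^ r i)` are of the form `r i * p ^ j`; for different `i` these never
coincide, so nothing cancels in `P`. -/
lemma exists_coeff_ne_zero (hp : p.Prime)
    (hη : ∀ i, IsAdditivePoly ((η i).map (toLaurentAtInfty F)))
    (hr : ∀ i, ¬ p ∣ r i) (hr_inj : Function.Injective r)
    (hP : P = C a₀ + ∑ i, (η i).comp (X ^ r i)) {i : Fin n} (hi : η i ≠ 0) :
    ∃ j, P.coeff (r i * p ^ j) ≠ 0 := by
  have := charP_laurentAtInfty (F := F) p
  have hpow : ∀ i q, (η i).coeff q ≠ 0 → ∃ e, q = p ^ e := by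
    intro i q hq
    refine (hη i).exists_eq_pow p hp (r := q) ?_
    rw [coeff_map]
    exact (map_ne_zero_iff _ toLaurentAtInfty_injective).2 hq
  have hr0 : ∀ i, 0 < r i := fun i => Nat.pos_of_ne_zero fun h => hr i (h ▸ dvd_zero p)
  obtain ⟨q, hq⟩ : ∃ q, (η i).coeff q ≠ 0 := by
    by_contra! h
    exact hi (Polynomial.ext fun q => by simpa using h q)
  obtain ⟨j, rfl⟩ := hpow i q hq
  refine ⟨j, ?_⟩
  have hne : r i * p ^ j ≠ 0 := (Nat.mul_pos (hr0 i) (pow_pos hp.pos j)).ne'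
  rw [hP, coeff_add, coeff_C, if_neg hne, zero_add, finsetSum_coeff, Finset.sum_eq_single i]
  · rw [← expand_eq_comp_X_pow, coeff_expand (hr0 i), if_pos (dvd_mul_right _ _),
      Nat.mul_div_cancel_left _ (hr0 i)]
    exact hq
  · intro i' _ hi'
    rw [← expand_eq_comp_X_pow, coeff_expand (hr0 i')]
    split_ifs with hdvd
    · by_contra hc
      obtain ⟨j', hj'⟩ := hpow i' _ hc
      have h1 : r i' * p ^ j' = r i * p ^ j := by rw [← hj', Nat.mul_div_cancel' hdvd]
      exact hi' (hr_inj (eq_of_mul_pow_eq_mul_pow hp (hr _) (hr _) h1).2)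
    · rfl
  · exact fun h => absurd (Finset.mem_univ i) h

end Decomposition

/-! ### Exponential sums along `P` modulo `Q` -/

section ExponentialSum

variable {F : Type*} [Field F] {p : ℕ} [CharP F p] {P : F[X][X]} {a₀ : F[X]} {n : ℕ}
  {η : Fin n → F[X][X]} {r : Fin n → ℕ} {Q : F[X]}

lemma aeval_eq_mk_add_sum (hη : ∀ i, IsAdditivePoly ((η i).map (toLaurentAtInfty F)))
    (hP : P = C a₀ + ∑ i, (η i).comp (X ^ r i)) (y : QuotRing Q) :
    aeval y P = Ideal.Quotient.mk (Ideal.span {Q}) a₀ +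
      ∑ i, additivePolyHom (hη i) Q (y ^ r i) := by
  rw [hP, map_add, aeval_C, map_sum, Ideal.Quotient.algebraMap_eq]
  congr 1
  refine Finset.sum_congr rfl fun i _ => ?_
  rw [aeval_comp, map_pow, aeval_X, additivePolyHom_apply]

variable [Finite F]

lemma one_le_derivDegree (P : F[X][X]) (hd : 0 < P.natDegree) :
    1 ≤ derivDegree (P.map (toLaurentAtInfty F)) := by
  have hp : (ringChar F).Prime := CharP.char_is_prime F _
  have := charP_laurentAtInfty (F := F) (ringChar F)
  refine (digitSum_pos hp.one_lt hd).trans_le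
    (digitSum_le_derivDegree (ringChar F) hp _ (r := P.natDegree) ?_)
  rw [coeff_map, coeff_natDegree]
  refine (map_ne_zero_iff _ toLaurentAtInfty_injective).2 ?_
  rw [leadingCoeff_ne_zero]
  rintro rfl
  simp at hd

/-- A Weyl-type bound for the exponential sum of a character which is nontrivial on `H_Q`. -/
theorem norm_sum_addChar_aeval_le
    (hη : ∀ i, IsAdditivePoly ((η i).map (toLaurentAtInfty F)))
    (hr : ∀ i, ¬ p ∣ r i) (hr_inj : Function.Injective r)
    (hP : P = C a₀ + ∑ i, (η i).comp (X ^ r i)) (hQ : Q.Monic) [Fintype (QuotRing Q)]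
    (ψ : AddChar (QuotRing Q) ℂ) (hψ : ∃ z ∈ sumOfImagesMod η Q, ψ z ≠ 1) :
    (‖∑ y : QuotRing Q, ψ (aeval y P)‖ / Fintype.card (QuotRing Q)) ^
        2 ^ (derivDegree (P.map (toLaurentAtInfty F)) - 1) ≤
      (p : ℝ) ^ (2 * Nat.log p P.natDegree) *
        (((derivDegree (P.map (toLaurentAtInfty F)) : ℝ) - 1) / lpf Q) := by
  classical
  have hp : p.Prime := CharP.char_is_prime F p
  have : Fact p.Prime := ⟨hp⟩
  have hcharK := charP_laurentAtInfty (F := F) p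
  have hr0 : ∀ i, 0 < r i := fun i => Nat.pos_of_ne_zero fun h => hr i (h ▸ dvd_zero p)
  set k := derivDegree (P.map (toLaurentAtInfty F)) with hk
  set L := Nat.log p P.natDegree with hL
  let θ : Fin n → AddChar (QuotRing Q) ℂ := fun i => ψ.compAddMonoidHom (additivePolyHom (hη i) Q)
  have hθ : ∀ i, θ i ≠ 1 → digitSum p (r i) ≤ k ∧ r i < p ^ (L + 1) := by
    intro i hi
    have hη0 : η i ≠ 0 := by
      intro h
      apply hi
      ext z
      simp [θ, additivePolyHom_apply, h]
    obtain ⟨j, hj⟩ := exists_coeff_ne_zero hp hη hr hr_inj hP hη0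
    constructor
    · rw [← digitSum_mul_pow hp.one_lt (r i) j]
      refine digitSum_le_derivDegree p hp _ ?_
      rw [coeff_map]
      exact (map_ne_zero_iff _ toLaurentAtInfty_injective).2 hj
    · refine lt_of_le_of_lt ?_ (Nat.lt_pow_succ_log_self hp.one_lt P.natDegree)
      exact (Nat.le_mul_of_pos_right _ (pow_pos hp.pos j)).trans (le_natDegree_of_ne_zero hj)
  obtain ⟨i₁, hi₁⟩ : ∃ i, θ i ≠ 1 := by
    obtain ⟨-, ⟨-, ⟨y, rfl⟩, rfl⟩, hz⟩ := hψ
    by_contra! h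
    apply hz
    simp only [map_sum]
    rw [AddChar.map_sum_eq_prod]
    refine Finset.prod_eq_one fun i _ => ?_
    rw [← additivePolyHom_mk (hη i)]
    have := DFunLike.congr_fun (h i) (Ideal.Quotient.mk (Ideal.span {Q}) (y i))
    simpa [θ] using this
  obtain ⟨i₂, hi₂, hmax⟩ := Finset.exists_max_image {i : Fin n | θ i ≠ 1} (fun i => digitSum p (r i))
    ⟨i₁, by simpa using hi₁⟩
  simp only [Finset.mem_filter, Finset.mem_univ, true_and] at hi₂ hmax
  obtain ⟨k', hk'⟩ := Nat.exists_eq_add_of_le' (digitSum_pos hp.one_lt (hr0 i₂))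
  let Ψ : ℕ → AddChar (QuotRing Q) ℂ := fun b => ∏ i, if r i = b then θ i else 1
  have hΨr : ∀ i, Ψ (r i) = θ i := by
    intro i
    simp only [Ψ]
    rw [Finset.prod_eq_single i]
    · simp
    · intro j _ hj
      rw [if_neg fun h => hj (hr_inj h)]
    · exact fun h => absurd (Finset.mem_univ i) h
  have hΨ : ∀ b, Ψ b ≠ 1 → ∃ i, r i = b ∧ θ i ≠ 1 := by
    intro b hb
    obtain ⟨i, -, hi⟩ := Finset.exists_ne_one_of_prod_ne_one hb
    split_ifs at hi with h
    · exact ⟨i, h, hi⟩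
    · exact absurd rfl hi
  -- This excludes `Q = 1`, where every character is trivial.
  have hnt : Nontrivial (QuotRing Q) := by
    by_contra hnt
    rw [not_nontrivial_iff_subsingleton] at hnt
    apply hi₂
    ext z
    rw [Subsingleton.elim z 0, AddChar.map_zero_eq_one, AddChar.map_zero_eq_one]
  have hchar : CharP (QuotRing Q) p := charP_of_injective_algebraMap
    (RingHom.injective (algebraMap F (QuotRing Q))) p
  obtain ⟨𝔪, h𝔪⟩ := Ideal.exists_maximal (QuotRing Q)
  have hlpf := (lpf_le_card_quotient hQ 𝔪 h𝔪.isPrime).1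
  have hmain := norm_sum_charProd_le p (L := L) hlpf
    (fun 𝔭 h𝔭 => (lpf_le_card_quotient hQ 𝔭 h𝔭).2) k' Ψ (by
      intro b hb
      obtain ⟨i, rfl, hi⟩ := hΨ b hb
      exact ⟨hr i, hk' ▸ hmax i hi, (hθ i hi).2⟩) ⟨r i₂, by rwa [hΨr], hk'⟩
  have hprod : ∀ y, charProd p L Ψ y = ψ (∑ i, additivePolyHom (hη i) Q (y ^ r i)) := by
    intro y
    rw [charProd, AddChar.map_sum_eq_prod]
    simp only [Ψ, AddChar.prod_apply]
    rw [Finset.prod_comm]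
    refine Finset.prod_congr rfl fun i _ => ?_
    rw [Finset.prod_eq_single (r i)]
    · simp [θ]
    · intro b _ hb
      rw [if_neg (Ne.symm hb), AddChar.one_apply]
    · intro hb
      rw [Finset.mem_range] at hb
      have : θ i = 1 := by
        by_contra h
        exact hb (hθ i h).2
      rw [this, ite_self, AddChar.one_apply]
  have hsum : ‖∑ y : QuotRing Q, ψ (aeval y P)‖ = ‖∑ y, charProd p L Ψ y‖ := by
    simp only [hprod, aeval_eq_mk_add_sum hη hP, AddChar.map_add_eq_mul]
    rw [← Finset.mul_sum, norm_mul, AddChar.norm_apply, one_mul]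
  have hcard : (0 : ℝ) < Fintype.card (QuotRing Q) := by exact_mod_cast Fintype.card_pos
  have hx1 : ‖∑ y : QuotRing Q, ψ (aeval y P)‖ / Fintype.card (QuotRing Q) ≤ 1 := by
    rw [div_le_one hcard]
    refine (norm_sum_le _ _).trans ?_
    simp [AddChar.norm_apply]
  have hkk : k' + 1 ≤ k := hk' ▸ (hθ i₂ hi₂).1
  rw [← hsum] at hmain
  have hkk' : (k' : ℝ) ≤ k - 1 := by
    have : ((k' + 1 : ℕ) : ℝ) ≤ k := by exact_mod_cast hkk
    push_cast at this
    linarith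
  -- The top digit sum `k' + 1` among nontrivial characters may be below `k`. The normalized sum is
  -- at most `1`, so raising the exponent is harmless.
  refine (pow_le_pow_of_le_one (by positivity) hx1
    (Nat.pow_le_pow_right two_pos (by omega : k' ≤ k - 1))).trans (hmain.trans ?_)
  gcongr

end ExponentialSum

/-! ### The subgroup `H_Q` -/

section Subgroup

variable {F : Type*} [Field F] {n : ℕ} {η : Fin n → F[X][X]}

/-- `H_Q` as an additive subgroup. -/
def sumOfImagesModSubgroup (hη : ∀ i, IsAdditivePoly ((η i).map (toLaurentAtInfty F))) (Q : F[X]) :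
    AddSubgroup (QuotRing Q) :=
  (∑ i, (additivePolyHom (hη i) Q).comp (Pi.evalAddMonoidHom (fun _ : Fin n => QuotRing Q) i)).range

lemma coe_sumOfImagesModSubgroup (hη : ∀ i, IsAdditivePoly ((η i).map (toLaurentAtInfty F)))
    (Q : F[X]) : (sumOfImagesModSubgroup hη Q : Set (QuotRing Q)) = sumOfImagesMod η Q := by
  ext z
  simp only [sumOfImagesModSubgroup, AddMonoidHom.coe_range, Set.mem_range, sumOfImagesMod,
    Set.mem_image, sumOfImages, Set.mem_ofPred_eq, AddMonoidHom.finsetSum_apply,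
    AddMonoidHom.comp_apply, Pi.evalAddMonoidHom_apply]
  constructor
  · rintro ⟨x, rfl⟩
    choose y hy using fun i => Ideal.Quotient.mk_surjective (x i)
    refine ⟨_, ⟨y, rfl⟩, ?_⟩
    rw [map_sum]
    exact Finset.sum_congr rfl fun i _ => by rw [← additivePolyHom_mk (hη i), hy]
  · rintro ⟨-, ⟨y, rfl⟩, rfl⟩
    refine ⟨fun i => Ideal.Quotient.mk _ (y i), ?_⟩
    rw [map_sum]
    exact Finset.sum_congr rfl fun i _ => additivePolyHom_mk (hη i) Q (y i)

end Subgroup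

/-! ### The main theorem -/

lemma avg_univ_eq_sum {α E : Type*} [Field E] [Fintype α] (f : α → E) :
    avg Set.univ f = (1 / (Fintype.card α : E)) * ∑ x, f x := by
  rw [avg, finsum_mem_univ, finsum_eq_sum_of_fintype, Set.ncard_univ, Nat.card_eq_fintype_card]

open Classical in
lemma avg_addSubgroup_eq_sum {A E : Type*} [Field E] [AddCommGroup A] [Fintype A] (H : AddSubgroup A)
    (f : A → E) : avg (H : Set A) f = (1 / (Fintype.card H : E)) * ∑ x : H, f x := by
  rw [avg, ← finsum_set_coe_eq_finsum_mem, finsum_eq_sum_of_fintype]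
  congr 3
  exact_mod_cast (Nat.card_coe_set_eq _).symm.trans (Nat.card_eq_fintype_card (α := H))

end

theorem mainTheorem11 {F : Type*} [Field F] [Finite F] (p : ℕ) [CharP F p]
    -- a nonconstant polynomial `P(y)` of degree `d` and derivational degree `k`
    (P : F[X][X]) (d k : ℕ) (hd : P.natDegree = d) (hd0 : 0 < d)
    (hk : derivDegree (P.map (toLaurentAtInfty F)) = k)
    -- the decomposition `P(y) = a₀ + ∑ᵢ ηᵢ(y ^ rᵢ)`
    (a₀ : F[X]) (n : ℕ) (η : Fin n → F[X][X]) (r : Fin n → ℕ)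
    (hη : ∀ i, IsAdditivePoly ((η i).map (toLaurentAtInfty F)))
    (hr : ∀ i, ¬ p ∣ r i) (hr_inj : Function.Injective r)
    (hP : P = C a₀ + ∑ i, (η i).comp (X ^ r i))
    (Q : F[X]) (hQ : Q.Monic) (m : ℕ) (f : (Fin m → QuotRing Q) → ℂ) :
    L2norm (fun x : Fin m → QuotRing Q =>
        avg Set.univ (fun y : QuotRing Q => f fun j => x j + aeval y P) -
        avg (sumOfImagesMod η Q) (fun z : QuotRing Q =>
          f fun j => x j + Ideal.Quotient.mk (Ideal.span {Q}) a₀ + z)) ≤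
      ((p : ℝ) ^ (2 * Nat.log p d) * (((k : ℝ) - 1) / (lpf Q : ℝ))) ^
          (1 / (2 : ℝ) ^ ((k : ℝ) - 1)) * L2norm f := by
  classical
  have hfin : Finite (QuotRing Q) := finite_quotRing hQ
  have := Fintype.ofFinite (QuotRing Q)
  subst hd hk
  set k := derivDegree (P.map (toLaurentAtInfty F)) with hk
  have hk1 : 1 ≤ k := one_le_derivDegree P hd0
  have hk1' : (0 : ℝ) ≤ (k : ℝ) - 1 := by
    have : ((1 : ℕ) : ℝ) ≤ k := by exact_mod_cast hk1
    push_cast at this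
    linarith
  set H := sumOfImagesModSubgroup hη Q with hH
  have hHmem : ∀ z, z ∈ H ↔ z ∈ sumOfImagesMod η Q := fun z => by
    rw [← coe_sumOfImagesModSubgroup hη, SetLike.mem_coe]
  set α := Ideal.Quotient.mk (Ideal.span {Q}) a₀ with hα
  let μ : QuotRing Q ⊕ H → ℂ :=
    Sum.elim (fun _ => 1 / Fintype.card (QuotRing Q)) (fun _ => -(1 / Fintype.card H))
  let s : QuotRing Q ⊕ H → Fin m → QuotRing Q :=
    Sum.elim (fun y _ => aeval y P) (fun z _ => α + z)
  have hT : (fun x : Fin m → QuotRing Q =>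
      avg Set.univ (fun y : QuotRing Q => f fun j => x j + aeval y P) -
      avg (sumOfImagesMod η Q) (fun z : QuotRing Q => f fun j => x j + α + z)) =
      fun x => ∑ v, μ v * f (x + s v) := by
    ext x
    rw [avg_univ_eq_sum, ← coe_sumOfImagesModSubgroup hη, avg_addSubgroup_eq_sum,
      Fintype.sum_sum_type]
    simp only [μ, s, Sum.elim_inl, Sum.elim_inr]
    rw [← Finset.mul_sum, ← Finset.mul_sum, neg_mul, ← sub_eq_add_neg]
    simp only [add_assoc]
    rfl
  rw [hT]
  -- For `Q = 1`, division by `lpf Q = 0` gives `0`, so the bound is zero; only the branch of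
  -- trivial `ψ` then occurs.
  have hb0 : 0 ≤ (p : ℝ) ^ (2 * Nat.log p P.natDegree) * (((k : ℝ) - 1) / (lpf Q : ℝ)) := by
    positivity
  refine L2norm_sum_mul_comp_add_le μ s (Real.rpow_nonneg hb0 _) (fun χ => ?_) f
  -- All shifts are diagonal, so only the restriction of `χ` to constant vectors matters.
  let ψ : AddChar (QuotRing Q) ℂ :=
    χ.compAddMonoidHom (Pi.constAddMonoidHom (Fin m) (QuotRing Q))
  have hψ : ∀ z, χ (fun _ => z) = ψ z := fun z => rfl
  have hmult : ∑ v, μ v * χ (s v) = 1 / Fintype.card (QuotRing Q) * ∑ y, ψ (aeval y P) -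
      1 / Fintype.card H * ∑ z : H, ψ (α + z) := by
    rw [Fintype.sum_sum_type]
    simp only [μ, s, Sum.elim_inl, Sum.elim_inr, hψ]
    rw [← Finset.mul_sum, ← Finset.mul_sum, neg_mul, ← sub_eq_add_neg]
  rw [hmult]
  have hcA : (Fintype.card (QuotRing Q) : ℂ) ≠ 0 := by exact_mod_cast Fintype.card_ne_zero
  have hcH : (Fintype.card H : ℂ) ≠ 0 := by exact_mod_cast Fintype.card_ne_zero
  by_cases htriv : ∀ z ∈ H, ψ z = 1
  · have h1 : ∀ y : QuotRing Q, ψ (aeval y P) = ψ α := by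
      intro y
      rw [aeval_eq_mk_add_sum hη hP, AddChar.map_add_eq_mul, htriv (∑ i, additivePolyHom (hη i) Q (y ^ r i))
        ⟨fun i => y ^ r i, by simp⟩, mul_one]
    have h2 : ∀ z : H, ψ (α + z) = ψ α := by
      intro z
      rw [AddChar.map_add_eq_mul, htriv _ z.2, mul_one]
    simp only [h1, h2, Finset.sum_const, Finset.card_univ, nsmul_eq_mul]
    rw [← mul_assoc, ← mul_assoc, one_div_mul_cancel hcA, one_div_mul_cancel hcH, sub_self,
      norm_zero]
    exact Real.rpow_nonneg hb0 _
  · push Not at htriv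
    obtain ⟨z₀, hz₀, hz₀ne⟩ := htriv
    have h1 : ∑ z : H, ψ (α + z) = 0 := by
      have h2 : ψ.compAddMonoidHom H.subtype ≠ 1 :=
        AddChar.ne_one_iff.2 ⟨⟨z₀, hz₀⟩, hz₀ne⟩
      have h3 := AddChar.sum_eq_zero_of_ne_one h2
      simp only [AddChar.map_add_eq_mul]
      rw [← Finset.mul_sum]
      exact mul_eq_zero_of_right _ h3
    rw [h1, mul_zero, sub_zero, norm_mul, norm_div, norm_one, Complex.norm_natCast,
      one_div_mul_eq_div]
    have hmain := norm_sum_addChar_aeval_le hη hr hr_inj hP hQ ψ ⟨z₀, (hHmem _).1 hz₀, hz₀ne⟩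
    rw [← hk] at hmain
    set x := ‖∑ y : QuotRing Q, ψ (aeval y P)‖ / Fintype.card (QuotRing Q) with hx
    have hx0 : 0 ≤ x := by positivity
    have hexp : (2 : ℝ) ^ ((k : ℝ) - 1) = ((2 ^ (k - 1) : ℕ) : ℝ) := by
      rw [show (k : ℝ) - 1 = ((k - 1 : ℕ) : ℝ) by rw [Nat.cast_sub hk1, Nat.cast_one],
        Real.rpow_natCast]
      push_cast
      rfl
    rw [hexp, one_div]
    calc x = (x ^ 2 ^ (k - 1)) ^ (((2 ^ (k - 1) : ℕ) : ℝ)⁻¹) :=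
          (Real.pow_rpow_inv_natCast hx0 (by positivity)).symm
      _ ≤ _ := Real.rpow_le_rpow (by positivity) hmain (by positivity)
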